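/- Let $\rho(x)=\max(x,0)$, acting componentwise on vectors. A ReLU network $\Psi$ with input dimension $N_0$ and output dimension $N_L$ is given by $L\ge 1$ affine maps $W_\ell(x)=A_\ell x+b_\ell$, $A_\ell\in\mathbb{R}^{N_\ell\times N_{\ell-1}}$, $b_\ell\in\mathbb{R}^{N_\ell}$, $1\le\ell\le L$, and realizes the map $W_L\circ\rho\circ W_{L-1}\circ\rho\circ\cdots\circ\rho\circ W_1$. Its depth is $\mathcal{L}(\Psi)=L$, its width is $\mathcal{W}(\Psi)=\max_{0\le\ell\le L}N_\ell$, and its weight magnitude $\mathcal{B}(\Psi)$ is the largest absolute value of an entry of any $A_\ell$ or $b_\ell$. Networks are required to be non-degenerate: every column of every $A_\ell$ and every row of $A_L$ has a nonzero entry. Write $\log$ for the logarithm to base $2$. For $p\in(0,1/2)$ and $a>0$ let $$W_{p,a}(x)=\sum_{k=0}^{\infty}p^k\cos(a^k\pi x),\qquad x\in\mathbb{R}.$$ There exists a constant $C>0$ such that for all $\epsilon,p\in(0,1/2)$ and all real $D,a>0$ there is a ReLU network $\Psi=\Psi_{p,a,D,\epsilon}$ with input and output dimension $1$ satisfying $$\sup_{x\in[-D,D]}|\Psi(x)-W_{p,a}(x)|\le\epsilon,$$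 with $$\mathcal{L}(\Psi)\le C\Big((\log(\epsilon^{-1}))^3+(\log(\epsilon^{-1}))^2\log(\lceil a\rceil)+\log(\epsilon^{-1})\log(\lceil D\rceil)\Big),$$ $\mathcal{W}(\Psi)\le 13$, and $\mathcal{B}(\Psi)\le 1$. -/

import Mathlib

/-- The ReLU activation function `ρ(x) = max(x, 0)`. -/
def relu (x : ℝ) : ℝ := max x 0

/-- ReLU neural networks with input dimension `d` and output dimension `d'`, given by their affine
maps `W_ℓ x = A_ℓ x + b_ℓ`, listed from the input to the output: either a single affine map, or
a first affine map `x ↦ A x + b` into `ℝⁿ`, followed by the componentwise ReLU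
and by a network with input dimension `n`. -/
inductive ReLUNetwork : ℕ → ℕ → Type where
  | affine {d d' : ℕ} (A : Matrix (Fin d') (Fin d) ℝ) (b : Fin d' → ℝ) : ReLUNetwork d d'
  | layer {d n d' : ℕ} (A : Matrix (Fin n) (Fin d) ℝ) (b : Fin n → ℝ)
      (Φ : ReLUNetwork n d') : ReLUNetwork d d'

namespace ReLUNetwork

/-- The map `W_L ∘ ρ ∘ W_{L-1} ∘ ρ ∘ ⋯ ∘ ρ ∘ W_1` realized by the network. -/
noncomputable def eval : {d d' : ℕ} → ReLUNetwork d d' → (Fin d → ℝ) → (Fin d' → ℝ)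
  | _, _, affine A b, x => A.mulVec x + b
  | _, _, layer A b Φ, x => Φ.eval fun i => relu ((A.mulVec x + b) i)

/-- The depth: the number `L` of affine maps. -/
def depth : {d d' : ℕ} → ReLUNetwork d d' → ℕ
  | _, _, affine _ _ => 1
  | _, _, layer _ _ Φ => Φ.depth + 1

/-- The width: the maximum of all layer dimensions `N_0, …, N_L` (input and output included). -/
def width : {d d' : ℕ} → ReLUNetwork d d' → ℕ
  | d, d', affine _ _ => max d d'
  | d, _, layer _ _ Φ => max d Φ.width

/-- The largest absolute value of an entry of the matrix `A` or of the vector `b`. -/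
noncomputable def affineMagnitude {m n : ℕ} (A : Matrix (Fin m) (Fin n) ℝ) (b : Fin m → ℝ) :
    NNReal :=
  max (Finset.univ.sup fun ij : Fin m × Fin n => ‖A ij.1 ij.2‖₊)
    (Finset.univ.sup fun i : Fin m => ‖b i‖₊)

/-- The weight magnitude: the largest absolute value of an entry of a matrix `A_ℓ` or of a
vector `b_ℓ`. -/
noncomputable def weightMagnitude : {d d' : ℕ} → ReLUNetwork d d' → NNReal
  | _, _, affine A b => affineMagnitude A b
  | _, _, layer A b Φ => max (affineMagnitude A b) Φ.weightMagnitude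

/-- Non-degeneracy: every node of the input layer and of the hidden layers has an outgoing edge
(each column of each `A_ℓ` has a nonzero entry), and every output node has an incoming edge (each
row of `A_L` has a nonzero entry). If the input dimension is positive, this forces all hidden
layers to be nonempty. -/
def Nondegenerate : {d d' : ℕ} → ReLUNetwork d d' → Prop
  | _, _, affine A _ => (∀ j, ∃ i, A i j ≠ 0) ∧ ∀ i, ∃ j, A i j ≠ 0
  | _, _, layer A _ Φ => (∀ j, ∃ i, A i j ≠ 0) ∧ Φ.Nondegenerate

end ReLUNetwork

/-- The Weierstrass function `W_{p,a}(x) = ∑_{k ≥ 0} p^k cos(a^k π x)`. -/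
noncomputable def weierstrassFn (p a x : ℝ) : ℝ :=
  ∑' k : ℕ, p ^ k * Real.cos (a ^ k * Real.pi * x)

/-- The series defining the Weierstrass function converges absolutely for `0 < p < 1`. -/
theorem weierstrassFn_summable {p : ℝ} (hp0 : 0 < p) (hp1 : p < 1) (a x : ℝ) :
    Summable fun k : ℕ => p ^ k * Real.cos (a ^ k * Real.pi * x) := by
  refine Summable.of_norm_bounded (summable_geometric_of_lt_one hp0.le hp1) fun k => ?_
  rw [norm_mul, Real.norm_eq_abs, Real.norm_eq_abs, abs_of_pos (pow_pos hp0 k)]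
  exact mul_le_of_le_one_right (pow_pos hp0 k).le (Real.abs_cos_le_one _)

/-! Since `p < 1/2`, about `log ε⁻¹` terms of the series suffice. For each term put `z = a^k |x| /
2^M`, with `M` so large that `z ∈ [0, 1]`. Folding `z` by `M` tent maps preserves the cosine
(`cos_pi_mul_tent_iterate`) and keeps all values bounded, and `cos (π t) = 1 - 2 sin² (π t / 2)`.

The squared sine doubles its angle under the logistic map `s ↦ 4 s (1 - s)`, itself a geometric
series of tent iterates (`logistic_eq_logisticApprox_add`). Start from `sin² w ≈ w²` at angle `π t /
2^(r+1)` and double `r` times: errors grow by 4 per doubling, but truncation at `2r` tent maps and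
the Taylor remainder are both of order `16^(-r)`, leaving `O(4^(-r))` (`abs_sinSqApprox_sub_le`).

Everything reduces to tent maps, run one after another on six nonnegative registers, so the width
stays fixed and each term costs depth `O(M + r²)`. Weights stay in `[-1, 1]` because factors of 2
come from duplicated registers. Nondegeneracy is obtained last, by perturbing zero weights
(`ReachableOn.exists_network`). -/

/-! ### Layer-by-layer construction and nondegeneracy by perturbation -/

/-- `ReachableOn K L f`: on the set `K`, the functions `f i` are the values of the neurons after `L`
hidden layers of width `n` with weights and biases in `[-1, 1]`. -/
inductive ReachableOn {n : ℕ} (K : Set ℝ) : ℕ → (Fin n → ℝ → ℝ) → Prop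
  | input {f : Fin n → ℝ → ℝ} (a b : Fin n → ℝ) (ha : ∀ i, |a i| ≤ 1) (hb : ∀ i, |b i| ≤ 1)
      (h : ∀ x ∈ K, ∀ i, f i x = relu (a i * x + b i)) : ReachableOn K 1 f
  | step {L : ℕ} {f g : Fin n → ℝ → ℝ} (A : Matrix (Fin n) (Fin n) ℝ) (b : Fin n → ℝ)
      (hA : ∀ i j, |A i j| ≤ 1) (hb : ∀ i, |b i| ≤ 1) (hf : ReachableOn K L f)
      (h : ∀ x ∈ K, ∀ i, g i x = relu (∑ j, A i j * f j x + b i)) : ReachableOn K (L + 1) g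

theorem relu_of_nonneg {x : ℝ} (h : 0 ≤ x) : relu x = x := max_eq_left h

theorem relu_of_nonpos {x : ℝ} (h : x ≤ 0) : relu x = 0 := max_eq_right h

theorem abs_relu_sub_le (x y : ℝ) : |relu x - relu y| ≤ |x - y| :=
  abs_max_sub_max_le_abs x y 0

theorem relu_add_relu_neg (x : ℝ) : relu x + relu (-x) = |x| := by
  rcases le_total 0 x with h | h
  · rw [relu_of_nonneg h, relu_of_nonpos (by linarith), abs_of_nonneg h, add_zero]
  · rw [relu_of_nonpos h, relu_of_nonneg (by linarith), abs_of_nonpos h, zero_add]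

namespace ReLUNetwork

theorem affineMagnitude_le_one {m n : ℕ} {A : Matrix (Fin m) (Fin n) ℝ} {b : Fin m → ℝ}
    (hA : ∀ i j, |A i j| ≤ 1) (hb : ∀ i, |b i| ≤ 1) : affineMagnitude A b ≤ 1 := by
  refine max_le (Finset.sup_le fun ij _ => ?_) (Finset.sup_le fun i _ => ?_)
  · exact_mod_cast hA ij.1 ij.2
  · exact_mod_cast hb i

theorem exists_lipschitzWith_mulVec {m n : ℕ} (A : Matrix (Fin m) (Fin n) ℝ) (b : Fin m → ℝ) :
    ∃ C, LipschitzWith C fun x => A.mulVec x + b := by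
  let l := (Matrix.toLin' A).toContinuousLinearMap
  refine ⟨‖l‖₊, LipschitzWith.of_dist_le_mul fun x y => ?_⟩
  rw [dist_add_right]
  exact l.lipschitz.dist_le_mul x y

theorem lipschitzWith_relu_comp (n : ℕ) :
    LipschitzWith 1 fun (x : Fin n → ℝ) i => relu (x i) := by
  refine LipschitzWith.of_dist_le_mul fun x y => ?_
  rw [NNReal.coe_one, one_mul, dist_pi_le_iff dist_nonneg]
  intro i
  refine le_trans ?_ (dist_le_pi_dist x y i)
  rw [Real.dist_eq, Real.dist_eq]
  exact abs_relu_sub_le _ _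

/-- The realization of a ReLU network is Lipschitz continuous. -/
theorem exists_lipschitzWith_eval {d d' : ℕ} (Φ : ReLUNetwork d d') :
    ∃ C, LipschitzWith C Φ.eval := by
  induction Φ with
  | affine A b => exact exists_lipschitzWith_mulVec A b
  | layer A b Φ ih =>
    obtain ⟨C, hC⟩ := ih
    obtain ⟨C', hC'⟩ := exists_lipschitzWith_mulVec A b
    exact ⟨_, hC.comp ((lipschitzWith_relu_comp _).comp hC')⟩

end ReLUNetwork

/-- Weights bounded by `1` can be made nonzero by an arbitrarily small change. -/
theorem exists_ne_zero_abs_sub_le {m n : Type*} (A : Matrix m n ℝ) (hA : ∀ i j, |A i j| ≤ 1)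
    {η : ℝ} (hη : 0 < η) :
    ∃ A' : Matrix m n ℝ, (∀ i j, |A' i j| ≤ 1) ∧ (∀ i j, A' i j ≠ 0) ∧
      ∀ i j, |A' i j - A i j| ≤ η := by
  have key (t : ℝ) (ht : |t| ≤ 1) : ∃ t' : ℝ, |t'| ≤ 1 ∧ t' ≠ 0 ∧ |t' - t| ≤ η := by
    by_cases h : t = 0
    · have hpos : 0 < min η 1 := lt_min hη one_pos
      refine ⟨min η 1, ?_, hpos.ne', ?_⟩
      · rw [abs_of_pos hpos]; exact min_le_right _ _
      · rw [h, sub_zero, abs_of_pos hpos]; exact min_le_left _ _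
    · exact ⟨t, ht, h, by simpa using hη.le⟩
  choose f h1 h2 h3 using key
  exact ⟨fun i j => f _ (hA i j), fun _ _ => h1 _ _, fun _ _ => h2 _ _, fun _ _ => h3 _ _⟩

namespace ReachableOn

variable {n : ℕ} {K : Set ℝ} {L : ℕ} {f : Fin n → ℝ → ℝ}

/-- A weight change moves the next layer in proportion to its incoming values, so this bound
determines how small the perturbations must be. -/
theorem exists_abs_le (h : ReachableOn K L f) {D : ℝ} (hK : ∀ x ∈ K, |x| ≤ D) :
    ∃ B, 0 ≤ B ∧ ∀ x ∈ K, ∀ i, |f i x| ≤ B := by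
  induction h with
  | input a b ha hb h =>
    refine ⟨|D| + 1, by positivity, fun x hx i => ?_⟩
    have h1 : |a i * x| ≤ |D| := by
      rw [abs_mul]
      have := (hK x hx).trans (le_abs_self D)
      nlinarith [ha i, abs_nonneg x, abs_nonneg (a i)]
    have h2 := abs_relu_sub_le (a i * x + b i) 0
    rw [relu_of_nonneg le_rfl, sub_zero, sub_zero] at h2
    rw [h x hx]
    exact h2.trans ((abs_add_le _ _).trans (add_le_add h1 (hb i)))
  | @step L f g A b hA hb hf h ih =>
    obtain ⟨B, hB0, hB⟩ := ih
    refine ⟨n * B + 1, by positivity, fun x hx i => ?_⟩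
    have h1 : |∑ j, A i j * f j x| ≤ n * B := by
      refine (Finset.abs_sum_le_sum_abs _ _).trans ?_
      refine (Finset.sum_le_card_nsmul _ _ B fun j _ => ?_).trans (by simp)
      rw [abs_mul]
      nlinarith [hA i j, hB x hx j, abs_nonneg (f j x)]
    have h2 := abs_relu_sub_le (∑ j, A i j * f j x + b i) 0
    rw [relu_of_nonneg le_rfl, sub_zero, sub_zero] at h2
    rw [h x hx]
    exact h2.trans ((abs_add_le _ _).trans (add_le_add h1 (hb i)))

/-- Reachable neuron values, followed by a nondegenerate network, are approximated on bounded sets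
by nondegenerate networks. -/
theorem exists_network [NeZero n] (h : ReachableOn K L f) {D : ℝ} (hK : ∀ x ∈ K, |x| ≤ D)
    {d W : ℕ} (hnW : n ≤ W) (hW : 1 ≤ W) (Φ : ReLUNetwork n d) (hΦ : Φ.Nondegenerate)
    (hΦW : Φ.width ≤ W) (hΦ1 : Φ.weightMagnitude ≤ 1) {δ : ℝ} (hδ : 0 < δ) :
    ∃ Ψ : ReLUNetwork 1 d, Ψ.Nondegenerate ∧ Ψ.depth = L + Φ.depth ∧ Ψ.width ≤ W ∧
      Ψ.weightMagnitude ≤ 1 ∧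
      ∀ x ∈ K, dist (Ψ.eval fun _ => x) (Φ.eval fun i => f i x) ≤ δ := by
  induction h generalizing Φ δ with
  | @input f a b ha hb h =>
    obtain ⟨C, hC⟩ := Φ.exists_lipschitzWith_eval
    obtain ⟨A', hA1, hA0, hA⟩ := exists_ne_zero_abs_sub_le
      (Matrix.of fun i (_ : Fin 1) => a i) (fun i _ => ha i)
      (η := δ / ((C + 1) * (|D| + 1))) (by positivity)
    refine ⟨.layer A' b Φ, ⟨fun j => ⟨0, hA0 _ _⟩, hΦ⟩, Nat.add_comm _ _, max_le hW hΦW,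
      max_le (ReLUNetwork.affineMagnitude_le_one hA1 hb) hΦ1, fun x hx => ?_⟩
    refine (hC.dist_le_mul _ _).trans ?_
    have : dist (fun i => relu ((A'.mulVec (fun _ => x) + b) i)) (fun i => f i x)
        ≤ δ / ((C + 1) * (|D| + 1)) * (|D| + 1) := by
      rw [dist_pi_le_iff (by positivity)]
      intro i
      rw [Real.dist_eq, h x hx]
      refine (abs_relu_sub_le _ _).trans ?_
      have e : (A'.mulVec (fun _ => x) + b) i - (a i * x + b i) = (A' i 0 - a i) * x := by
        simp [Matrix.mulVec, dotProduct]; ring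
      rw [e, abs_mul]
      have hx' := (hK x hx).trans (le_abs_self D)
      exact mul_le_mul (hA i 0) (by linarith) (abs_nonneg _) (by positivity)
    calc (C : ℝ) * _ ≤ C * (δ / ((C + 1) * (|D| + 1)) * (|D| + 1)) := by gcongr
      _ = C / (C + 1) * δ := by field_simp
      _ ≤ 1 * δ := by
        gcongr
        rw [div_le_one (by positivity)]
        linarith
      _ = δ := one_mul δ
  | @step L f g A b hA hb hf h ih =>
    obtain ⟨B, hB0, hB⟩ := hf.exists_abs_le hK
    obtain ⟨C, hC⟩ := Φ.exists_lipschitzWith_eval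
    obtain ⟨A', hA1, hA0, hA'⟩ := exists_ne_zero_abs_sub_le A hA
      (η := δ / 2 / ((C + 1) * (n * B + 1))) (by positivity)
    -- The perturbed layer is absorbed into the tail network; half of `δ` pays for it and half for
    -- all earlier layers.
    obtain ⟨Ψ, hΨ, hdepth, hwidth, hmag, hdist⟩ := ih (.layer A' b Φ)
      ⟨fun j => ⟨0, hA0 _ _⟩, hΦ⟩ (max_le hnW hΦW)
      (max_le (ReLUNetwork.affineMagnitude_le_one hA1 hb) hΦ1) (half_pos hδ)
    refine ⟨Ψ, hΨ, ?_, hwidth, hmag, fun x hx => ?_⟩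
    · rw [hdepth, ReLUNetwork.depth]; ring
    refine (dist_triangle _ _ _).trans ((add_le_add (hdist x hx) ?_).trans (add_halves δ).le)
    refine (hC.dist_le_mul _ _).trans ?_
    have : dist (fun i => relu ((A'.mulVec (fun i => f i x) + b) i)) (fun i => g i x)
        ≤ δ / 2 / ((C + 1) * (n * B + 1)) * (n * B + 1) := by
      rw [dist_pi_le_iff (by positivity)]
      intro i
      rw [Real.dist_eq, h x hx]
      refine (abs_relu_sub_le _ _).trans ?_
      have e : (A'.mulVec (fun i => f i x) + b) i - (∑ j, A i j * f j x + b i)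
          = ∑ j, (A' i j - A i j) * f j x := by
        simp [Matrix.mulVec, dotProduct, sub_mul, Finset.sum_sub_distrib]
      rw [e]
      set η := δ / 2 / ((C + 1) * (n * B + 1)) with hη
      have hη0 : 0 ≤ η := by positivity
      refine (Finset.abs_sum_le_sum_abs _ _).trans ?_
      refine (Finset.sum_le_card_nsmul _ _ (η * B) fun j _ => ?_).trans ?_
      · rw [abs_mul]
        exact mul_le_mul (hA' i j) (hB x hx j) (abs_nonneg _) hη0
      · simp only [Finset.card_univ, Fintype.card_fin, nsmul_eq_mul]
        nlinarith
    calc (C : ℝ) * _ ≤ C * (δ / 2 / ((C + 1) * (n * B + 1)) * (n * B + 1)) := by gcongr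
      _ = C / (C + 1) * (δ / 2) := by field_simp
      _ ≤ 1 * (δ / 2) := by
        gcongr
        rw [div_le_one (by positivity)]
        linarith
      _ = δ / 2 := one_mul _

end ReachableOn

/-! ### Tent maps, the logistic map and the squared sine -/

/-- The tent map, for arguments in `[0, 1]`. -/
def tent (z : ℝ) : ℝ := 2 * z - 2 * relu (2 * z - 1)

theorem tent_cases (z : ℝ) : z ≤ 1 / 2 ∧ tent z = 2 * z ∨ 1 / 2 ≤ z ∧ tent z = 2 - 2 * z := by
  rcases le_total z (1 / 2) with h | h
  · exact .inl ⟨h, by rw [tent, relu_of_nonpos (by linarith)]; ring⟩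
  · exact .inr ⟨h, by rw [tent, relu_of_nonneg (by linarith)]; ring⟩

theorem tent_mem_Icc {z : ℝ} (hz : z ∈ Set.Icc (0 : ℝ) 1) : tent z ∈ Set.Icc (0 : ℝ) 1 := by
  obtain ⟨h0, h1⟩ := hz
  rcases tent_cases z with ⟨h, e⟩ | ⟨h, e⟩ <;> rw [e] <;> constructor <;> linarith

theorem tent_iterate_mem_Icc {z : ℝ} (hz : z ∈ Set.Icc (0 : ℝ) 1) (m : ℕ) :
    tent^[m] z ∈ Set.Icc (0 : ℝ) 1 :=
  Set.MapsTo.iterate (fun _ h => tent_mem_Icc h) m hz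

theorem cos_pi_mul_tent (z : ℝ) : Real.cos (Real.pi * tent z) = Real.cos (Real.pi * (2 * z)) := by
  rcases tent_cases z with ⟨_, e⟩ | ⟨_, e⟩ <;> rw [e]
  rw [show Real.pi * (2 - 2 * z) = 2 * Real.pi - Real.pi * (2 * z) by ring,
    Real.cos_two_pi_sub]

/-- The cosine of a doubled angle depends only on the square of the cosine, so equality of cosines
survives each doubling. -/
theorem cos_pi_mul_tent_iterate (m : ℕ) (z : ℝ) :
    Real.cos (Real.pi * tent^[m] z) = Real.cos (Real.pi * (2 ^ m * z)) := by
  induction m generalizing z with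
  | zero => simp
  | succ m ih =>
    have h := Real.cos_sq (Real.pi * tent^[m] z)
    have h' := Real.cos_sq (Real.pi * (2 ^ m * z))
    rw [ih] at h
    rw [Function.iterate_succ_apply', cos_pi_mul_tent,
      show Real.pi * (2 * tent^[m] z) = 2 * (Real.pi * tent^[m] z) by ring,
      show Real.pi * (2 ^ (m + 1) * z) = 2 * (Real.pi * (2 ^ m * z)) by ring]
    linarith

/-- Partial sums of the expansion of the logistic map in iterates of the tent map. -/
noncomputable def logisticApprox (m : ℕ) (s : ℝ) : ℝ :=
  ∑ k ∈ Finset.range m, (1 / 4) ^ k * tent^[k + 1] s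

/-- With `g t = 4 t (1 - t)`, both branches of the tent map satisfy `g t = tent t + g (tent t) / 4`;
iterate this. -/
theorem logistic_eq_logisticApprox_add (m : ℕ) (s : ℝ) :
    4 * s * (1 - s) =
      logisticApprox m s + (1 / 4) ^ m * (4 * tent^[m] s * (1 - tent^[m] s)) := by
  induction m with
  | zero => simp [logisticApprox]
  | succ m ih =>
    rw [ih, logisticApprox, logisticApprox, Finset.sum_range_succ, Function.iterate_succ_apply',
      pow_succ]
    rcases tent_cases (tent^[m] s) with ⟨_, e⟩ | ⟨_, e⟩ <;> rw [e] <;> ring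

theorem logisticApprox_nonneg {s : ℝ} (hs : s ∈ Set.Icc (0 : ℝ) 1) (m : ℕ) :
    0 ≤ logisticApprox m s :=
  Finset.sum_nonneg fun k _ => mul_nonneg (by positivity) (tent_iterate_mem_Icc hs _).1

theorem logisticApprox_le {s : ℝ} (hs : s ∈ Set.Icc (0 : ℝ) 1) (m : ℕ) :
    logisticApprox m s ≤ 4 * s * (1 - s) := by
  have h := tent_iterate_mem_Icc hs m
  rw [logistic_eq_logisticApprox_add m s]
  have : 0 ≤ 4 * tent^[m] s * (1 - tent^[m] s) :=
    mul_nonneg (mul_nonneg zero_le_four h.1) (sub_nonneg.2 h.2)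
  have h4 : (0 : ℝ) ≤ (1 / 4) ^ m := by positivity
  nlinarith

theorem le_logisticApprox_add {s : ℝ} (m : ℕ) :
    4 * s * (1 - s) ≤ logisticApprox m s + (1 / 4) ^ m := by
  rw [logistic_eq_logisticApprox_add m s]
  have h4 : (0 : ℝ) ≤ (1 / 4) ^ m := by positivity
  have : 4 * tent^[m] s * (1 - tent^[m] s) ≤ 1 := by nlinarith [sq_nonneg (2 * tent^[m] s - 1)]
  nlinarith

theorem logisticApprox_mem_Icc {s : ℝ} (hs : s ∈ Set.Icc (0 : ℝ) 1) (m : ℕ) :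
    logisticApprox m s ∈ Set.Icc (0 : ℝ) 1 :=
  ⟨logisticApprox_nonneg hs m,
    (logisticApprox_le hs m).trans (by nlinarith [sq_nonneg (2 * s - 1)])⟩

theorem logisticApprox_iterate_mem_Icc {s : ℝ} (hs : s ∈ Set.Icc (0 : ℝ) 1) (m j : ℕ) :
    (logisticApprox m)^[j] s ∈ Set.Icc (0 : ℝ) 1 :=
  Set.MapsTo.iterate (fun _ h => logisticApprox_mem_Icc h m) j hs

/-- The logistic map is 4-Lipschitz on `[0, 1]`, and each step adds a truncation error of at most
`(1 / 4) ^ m`. Subtracting `(1 / 4) ^ m` at the end makes the induction close. -/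
theorem abs_logisticApprox_iterate_sub_le {s : ℝ} (hs : s ∈ Set.Icc (0 : ℝ) 1) (m j : ℕ) (w : ℝ) :
    |(logisticApprox m)^[j] s - Real.sin (2 ^ j * w) ^ 2| ≤
      4 ^ j * (|s - Real.sin w ^ 2| + (1 / 4) ^ m) - (1 / 4) ^ m := by
  induction j with
  | zero => simp
  | succ j ih =>
    rw [Function.iterate_succ_apply', pow_succ 2, mul_right_comm, mul_comm _ (2 : ℝ),
      Real.sin_two_mul]
    have ht := logisticApprox_iterate_mem_Icc hs m j
    set t := (logisticApprox m)^[j] s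
    set θ := 2 ^ j * w
    have hc : Real.cos θ ^ 2 = 1 - Real.sin θ ^ 2 := Real.cos_sq' θ
    have e : (2 * Real.sin θ * Real.cos θ) ^ 2 = 4 * Real.sin θ ^ 2 * (1 - Real.sin θ ^ 2) := by
      rw [← hc]; ring
    rw [e]
    have hu1 : Real.sin θ ^ 2 ≤ 1 := Real.sin_sq_le_one θ
    have hu0 : 0 ≤ Real.sin θ ^ 2 := sq_nonneg _
    set u := Real.sin θ ^ 2
    have h1 : |logisticApprox m t - 4 * t * (1 - t)| ≤ (1 / 4) ^ m := by
      have := logisticApprox_le ht m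
      have := @le_logisticApprox_add t m
      rw [abs_le]; constructor <;> linarith [show (0 : ℝ) ≤ (1 / 4) ^ m by positivity]
    have h2 : |4 * t * (1 - t) - 4 * u * (1 - u)| ≤ 4 * |t - u| := by
      rw [show 4 * t * (1 - t) - 4 * u * (1 - u) = 4 * (1 - t - u) * (t - u) by ring, abs_mul]
      gcongr
      rw [abs_le]; constructor <;> linarith [ht.1, ht.2]
    have h3 := abs_sub_le (logisticApprox m t) (4 * t * (1 - t)) (4 * u * (1 - u))
    rw [pow_succ]
    have h4 : (0 : ℝ) ≤ (1 / 4) ^ m := by positivity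
    linarith

/-- An approximation of `w ^ 2` from above. -/
noncomputable def squareApprox (m : ℕ) (w : ℝ) : ℝ := w - 1 / 4 * logisticApprox m w

theorem sq_le_squareApprox {w : ℝ} (hw : w ∈ Set.Icc (0 : ℝ) 1) (m : ℕ) :
    w ^ 2 ≤ squareApprox m w := by
  have := logisticApprox_le hw m
  rw [squareApprox]; nlinarith

theorem squareApprox_mem_Icc {w : ℝ} (hw : w ∈ Set.Icc (0 : ℝ) 1) (m : ℕ) :
    squareApprox m w ∈ Set.Icc (0 : ℝ) 1 := by
  refine ⟨(sq_nonneg w).trans (sq_le_squareApprox hw m), ?_⟩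
  have := logisticApprox_nonneg hw m
  rw [squareApprox]; linarith [hw.2]

theorem abs_squareApprox_sub_sin_sq_le {w : ℝ} (hw : w ∈ Set.Icc (0 : ℝ) 1) (m : ℕ) :
    |squareApprox m w - Real.sin w ^ 2| ≤ 1 / 4 * (1 / 4) ^ m + w ^ 4 / 2 := by
  have h1 := sq_le_squareApprox hw m
  have h2 := @le_logisticApprox_add w m
  have h3 : squareApprox m w ≤ w ^ 2 + 1 / 4 * (1 / 4) ^ m := by
    rw [squareApprox]; linarith
  have h4 : Real.sin w ≤ w := Real.sin_le hw.1
  have h5 : w - w ^ 3 / 4 ≤ Real.sin w := by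
    rcases hw.1.eq_or_lt with h | h
    · simp [← h]
    · linarith [Real.sin_gt_sub_cube h, pow_pos h 3]
  have h6 : 0 ≤ Real.sin w := Real.sin_nonneg_of_nonneg_of_le_pi hw.1
    (hw.2.trans (by linarith [Real.pi_gt_three]))
  have h7 : w ^ 2 - Real.sin w ^ 2 ≤ w ^ 4 / 2 := by
    rw [show w ^ 2 - Real.sin w ^ 2 = (w - Real.sin w) * (w + Real.sin w) by ring,
      show w ^ 4 / 2 = w ^ 3 / 4 * (2 * w) by ring]
    have := pow_nonneg hw.1 3
    apply mul_le_mul <;> linarith [hw.1]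
  have h8 : Real.sin w ^ 2 ≤ w ^ 2 := pow_le_pow_left₀ h6 h4 2
  rw [abs_of_nonneg] <;> linarith

/-- The approximation of `sin (π z / 2) ^ 2` for `z ∈ [0, 1]` by `r` angle doublings. -/
noncomputable def sinSqApprox (r : ℕ) (z : ℝ) : ℝ :=
  (logisticApprox (2 * r))^[r] (squareApprox (2 * r) (Real.pi / 2 ^ (r + 1) * z))

theorem pi_div_two_pow_le_one {r : ℕ} (hr : 1 ≤ r) : Real.pi / 2 ^ (r + 1) ≤ 1 := by
  rw [div_le_one (by positivity)]
  have : (2 : ℝ) ^ 2 ≤ 2 ^ (r + 1) := pow_le_pow_right₀ one_le_two (by omega)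
  linarith [Real.pi_le_four]

theorem pi_div_two_pow_mul_mem_Icc {r : ℕ} (hr : 1 ≤ r) {z : ℝ} (hz : z ∈ Set.Icc (0 : ℝ) 1) :
    Real.pi / 2 ^ (r + 1) * z ∈ Set.Icc (0 : ℝ) 1 :=
  ⟨mul_nonneg (by positivity) hz.1,
    mul_le_one₀ (pi_div_two_pow_le_one hr) hz.1 hz.2⟩

theorem sinSqApprox_mem_Icc {r : ℕ} (hr : 1 ≤ r) {z : ℝ} (hz : z ∈ Set.Icc (0 : ℝ) 1) :
    sinSqApprox r z ∈ Set.Icc (0 : ℝ) 1 :=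
  logisticApprox_iterate_mem_Icc
    (squareApprox_mem_Icc (pi_div_two_pow_mul_mem_Icc hr hz) _) _ _

theorem abs_sinSqApprox_sub_le {r : ℕ} (hr : 1 ≤ r) {z : ℝ} (hz : z ∈ Set.Icc (0 : ℝ) 1) :
    |sinSqApprox r z - Real.sin (Real.pi * z / 2) ^ 2| ≤ 6 * (1 / 4) ^ r := by
  have hw := pi_div_two_pow_mul_mem_Icc hr hz
  have h1 := abs_logisticApprox_iterate_sub_le (squareApprox_mem_Icc hw (2 * r)) (2 * r) r
    (Real.pi / 2 ^ (r + 1) * z)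
  rw [show (2 : ℝ) ^ r * (Real.pi / 2 ^ (r + 1) * z) = Real.pi * z / 2 by
    rw [pow_succ]; field_simp] at h1
  have h2 := abs_squareApprox_sub_sin_sq_le hw (2 * r)
  -- The constant 8 bounds `π ^ 4 / 16`. The total is then `1/4 + 8/2 + 1 ≤ 6` in units of `(1 / 4)
  -- ^ (2 * r)`.
  have h3 : (Real.pi / 2 ^ (r + 1) * z) ^ 4 ≤ 8 * (1 / 4) ^ (2 * r) := by
    have e : (Real.pi / 2 ^ (r + 1) * z) ^ 4 = Real.pi ^ 4 / 16 * z ^ 4 * (1 / 4) ^ (2 * r) := by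
      rw [mul_pow, div_pow, ← pow_mul, show (r + 1) * 4 = 2 * (2 * r) + 4 by ring, pow_add,
        pow_mul 2 2, one_div, inv_pow]
      norm_num
      field_simp
    rw [e]
    have hz4 : z ^ 4 ≤ 1 := pow_le_one₀ hz.1 hz.2
    have hz0 : 0 ≤ z ^ 4 := pow_nonneg hz.1 4
    have hpi : Real.pi ^ 4 ≤ 128 := by
      have := pow_le_pow_left₀ Real.pi_pos.le Real.pi_lt_d2.le 4
      exact this.trans (by norm_num)
    gcongr
    have : 0 ≤ Real.pi ^ 4 := by positivity
    nlinarith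
  have h4 : (4 : ℝ) ^ r * (1 / 4) ^ (2 * r) = (1 / 4) ^ r := by
    rw [two_mul, pow_add, ← mul_assoc, ← mul_pow]; norm_num
  have h5 : (0 : ℝ) ≤ (1 / 4) ^ (2 * r) := by positivity
  have h6 : (4 : ℝ) ^ r * (|squareApprox (2 * r) (Real.pi / 2 ^ (r + 1) * z) -
      Real.sin (Real.pi / 2 ^ (r + 1) * z) ^ 2| + (1 / 4) ^ (2 * r)) ≤
      4 ^ r * (6 * (1 / 4) ^ (2 * r)) := by
    gcongr
    linarith
  rw [sinSqApprox]
  linarith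

/-! ### Realization on six registers -/

namespace ReachableOn

variable {K : Set ℝ} {L : ℕ} {X T A z : ℝ → ℝ}

/-- Cosine is even, so `|x|` can replace `x`; being nonnegative, it passes through every ReLU
unchanged. The registers are the input `X`, the running total `T`, an accumulator `A`, two copies of
the working value `z`, and a spare. -/
theorem abs_input (K : Set ℝ) :
    ReachableOn K 2 ![fun x => |x|, fun _ => 0, fun _ => 0, fun _ => 0, fun _ => 0, fun _ => 0] := by
  refine .step (L := 1)
    (f := ![fun x => relu x, fun x => relu (-x), fun _ => 0, fun _ => 0, fun _ => 0, fun _ => 0])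
    !![1, 1, 0, 0, 0, 0; 0, 0, 0, 0, 0, 0; 0, 0, 0, 0, 0, 0; 0, 0, 0, 0, 0, 0; 0, 0, 0, 0, 0, 0;
      0, 0, 0, 0, 0, 0] 0 ?_ ?_
    (.input ![1, -1, 0, 0, 0, 0] 0 ?_ ?_ ?_) ?_
  · intro i j; fin_cases i <;> fin_cases j <;> simp
  · intro i; simp
  · intro i; fin_cases i <;> simp
  · intro i; simp
  · intro x _ i; fin_cases i <;> simp [relu]
  · intro x _ i
    have h := relu_add_relu_neg x
    fin_cases i <;> simp [Fin.sum_univ_succ, h, relu_of_nonneg]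

/-- A layer that combines the registers linearly. -/
theorem combine (h : ReachableOn K L ![X, T, A, z, z, fun _ => 0])
    (hX : ∀ x ∈ K, 0 ≤ X x) (hT : ∀ x ∈ K, 0 ≤ T x) (hA : ∀ x ∈ K, 0 ≤ A x)
    (hz : ∀ x ∈ K, 0 ≤ z x) {c₁ c₂ c₃ c₄ c₅ : ℝ} (h₁ : c₁ ∈ Set.Icc (0 : ℝ) 1)
    (h₂ : c₂ ∈ Set.Icc (0 : ℝ) 1) (h₃ : c₃ ∈ Set.Icc (0 : ℝ) 1) (h₄ : c₄ ∈ Set.Icc (0 : ℝ) 1)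
    (h₅ : c₅ ∈ Set.Icc (0 : ℝ) 1) {T' A' z' : ℝ → ℝ}
    (hT' : ∀ x ∈ K, T' x = T x + c₁ * A x) (hA' : ∀ x ∈ K, A' x = c₂ * z x)
    (hz' : ∀ x ∈ K, z' x = c₃ * X x + c₄ * A x + c₅ * z x) :
    ReachableOn K (L + 1) ![X, T', A', z', z', fun _ => 0] := by
  have key {c : ℝ} (hc : c ∈ Set.Icc (0 : ℝ) 1) : |c| ≤ 1 := by rw [abs_of_nonneg hc.1]; exact hc.2
  refine .step
    !![1, 0, 0, 0, 0, 0; 0, 1, c₁, 0, 0, 0; 0, 0, 0, c₂, 0, 0; c₃, 0, c₄, c₅, 0, 0;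
      c₃, 0, c₄, c₅, 0, 0; 0, 0, 0, 0, 0, 0] 0 ?_ ?_ h ?_
  · intro i j
    fin_cases i <;> fin_cases j <;> simp [key h₁, key h₂, key h₃, key h₄, key h₅]
  · intro i; simp
  · intro x hx i
    have e1 : 0 ≤ T x + c₁ * A x := add_nonneg (hT x hx) (mul_nonneg h₁.1 (hA x hx))
    have e2 : 0 ≤ c₂ * z x := mul_nonneg h₂.1 (hz x hx)
    have e3 : 0 ≤ c₃ * X x + (c₄ * A x + c₅ * z x) :=
      add_nonneg (mul_nonneg h₃.1 (hX x hx))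
        (add_nonneg (mul_nonneg h₄.1 (hA x hx)) (mul_nonneg h₅.1 (hz x hx)))
    fin_cases i <;>
      simp [Fin.sum_univ_succ, relu_of_nonneg, hX x hx, hT' x hx, hA' x hx, hz' x hx, e1, e2, e3,
        add_assoc]

/-- Two layers that apply the tent map. -/
theorem tent_step (h : ReachableOn K L ![X, T, A, z, z, fun _ => 0])
    (hX : ∀ x ∈ K, 0 ≤ X x) (hT : ∀ x ∈ K, 0 ≤ T x) (hA : ∀ x ∈ K, 0 ≤ A x)
    (hz : ∀ x ∈ K, z x ∈ Set.Icc (0 : ℝ) 1) {c : ℝ} (hc : |c| ≤ 1) {A' : ℝ → ℝ}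
    (hA' : ∀ x ∈ K, 0 ≤ A' x) (hA'' : ∀ x ∈ K, A' x = A x + c * tent (z x)) :
    ReachableOn K (L + 2) ![X, T, A', fun x => tent (z x), fun x => tent (z x), fun _ => 0] := by
  -- Adding the two copies of `z` gives `2 z` with unit weights. The kink `relu (2 * z - 1)` is
  -- stored twice, using the spare register, so that its factor 2 also needs only unit weights.
  refine .step (L := L + 1)
    (f := ![X, T, A, fun x => 2 * z x, fun x => relu (2 * z x - 1), fun x => relu (2 * z x - 1)])
    !![1, 0, 0, 0, 0, 0; 0, 1, 0, 0, 0, 0; 0, 0, 1, c, -c, -c; 0, 0, 0, 1, -1, -1;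
      0, 0, 0, 1, -1, -1; 0, 0, 0, 0, 0, 0] 0 ?_ ?_
    (.step
      !![1, 0, 0, 0, 0, 0; 0, 1, 0, 0, 0, 0; 0, 0, 1, 0, 0, 0; 0, 0, 0, 1, 1, 0;
        0, 0, 0, 1, 1, 0; 0, 0, 0, 1, 1, 0] ![0, 0, 0, 0, -1, -1] ?_ ?_ h ?_) ?_
  · intro i j; fin_cases i <;> fin_cases j <;> simp [hc]
  · intro i; simp
  · intro i j; fin_cases i <;> fin_cases j <;> simp
  · intro i; fin_cases i <;> simp
  · intro x hx i
    fin_cases i <;>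
      simp [Fin.sum_univ_succ, relu_of_nonneg, hX x hx, hT x hx, hA x hx, (hz x hx).1, ← two_mul,
        sub_eq_add_neg]
  · intro x hx i
    have e1 : tent (z x) = 2 * z x + (-relu (2 * z x - 1) + -relu (2 * z x - 1)) := by
      rw [tent]; ring
    have e2 : A' x = A x + (c * (2 * z x) + (-(c * relu (2 * z x - 1)) +
        -(c * relu (2 * z x - 1)))) := by
      rw [hA'' x hx, tent]; ring
    have e3 := (tent_mem_Icc (hz x hx)).1
    have e4 := hA' x hx
    fin_cases i <;>
      simp [Fin.sum_univ_succ, relu_of_nonneg, hX x hx, hT x hx, ← e1, ← e2, e3, e4]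

/-- Iterating the tent map and accumulating a linear combination of the iterates. -/
theorem tent_iterate (h : ReachableOn K L ![X, T, A, z, z, fun _ => 0])
    (hX : ∀ x ∈ K, 0 ≤ X x) (hT : ∀ x ∈ K, 0 ≤ T x)
    (hz : ∀ x ∈ K, z x ∈ Set.Icc (0 : ℝ) 1) {c : ℕ → ℝ} (hc : ∀ k, |c k| ≤ 1)
    (hA : ∀ m, ∀ x ∈ K, 0 ≤ A x + ∑ k ∈ Finset.range m, c k * tent^[k + 1] (z x)) (m : ℕ) :
    ReachableOn K (L + 2 * m)
      ![X, T, fun x => A x + ∑ k ∈ Finset.range m, c k * tent^[k + 1] (z x),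
        fun x => tent^[m] (z x), fun x => tent^[m] (z x), fun _ => 0] := by
  induction m with
  | zero => simpa using h
  | succ m ih =>
    have := ih.tent_step hX hT (hA m) (fun x hx => tent_iterate_mem_Icc (hz x hx) m) (hc m)
      (hA (m + 1)) fun x _ => by
        rw [Finset.sum_range_succ, ← add_assoc, Function.iterate_succ_apply']
    simp only [← Function.iterate_succ_apply'] at this
    exact this

/-- Layers that apply the approximate logistic map to the accumulator. -/
theorem logistic_step (h : ReachableOn K L ![X, T, A, z, z, fun _ => 0])
    (hX : ∀ x ∈ K, 0 ≤ X x) (hT : ∀ x ∈ K, 0 ≤ T x) (hz : ∀ x ∈ K, 0 ≤ z x)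
    (hA : ∀ x ∈ K, A x ∈ Set.Icc (0 : ℝ) 1) (m : ℕ) :
    ∃ z' : ℝ → ℝ, (∀ x ∈ K, 0 ≤ z' x) ∧ ReachableOn K (L + (1 + 2 * m))
      ![X, T, fun x => logisticApprox m (A x), z', z', fun _ => 0] := by
  have h0 : (0 : ℝ) ∈ Set.Icc (0 : ℝ) 1 := by simp
  have h1 := h.combine hX hT (fun x hx => (hA x hx).1) hz (c₁ := 0) (c₂ := 0) (c₃ := 0) (c₄ := 1)
    (c₅ := 0) h0 h0 h0 (by simp) h0 (T' := T) (A' := fun _ => 0) (z' := A)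
    (by simp) (by simp) (by simp)
  have h2 := h1.tent_iterate hX hT hA (c := fun k => (1 / 4) ^ k)
    (fun k => by
      rw [abs_of_nonneg (by positivity)]
      exact pow_le_one₀ (by norm_num) (by norm_num))
    (fun m x hx => by simpa [logisticApprox] using logisticApprox_nonneg (hA x hx) m) m
  refine ⟨_, fun x hx => (tent_iterate_mem_Icc (hA x hx) m).1, ?_⟩
  rw [← add_assoc]
  simpa [logisticApprox] using h2

/-- Each pass reloads `z` from `A`, so the leftover `z'` matters only through its sign. -/
theorem logistic_iterate (h : ReachableOn K L ![X, T, A, z, z, fun _ => 0])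
    (hX : ∀ x ∈ K, 0 ≤ X x) (hT : ∀ x ∈ K, 0 ≤ T x) (hz : ∀ x ∈ K, 0 ≤ z x)
    (hA : ∀ x ∈ K, A x ∈ Set.Icc (0 : ℝ) 1) (m r : ℕ) :
    ∃ z' : ℝ → ℝ, (∀ x ∈ K, 0 ≤ z' x) ∧ ReachableOn K (L + r * (1 + 2 * m))
      ![X, T, fun x => (logisticApprox m)^[r] (A x), z', z', fun _ => 0] := by
  induction r with
  | zero => exact ⟨z, hz, by simpa using h⟩
  | succ r ih =>
    obtain ⟨z', hz', h'⟩ := ih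
    obtain ⟨z'', hz'', h''⟩ := h'.logistic_step hX hT hz'
      (fun x hx => logisticApprox_iterate_mem_Icc (hA x hx) m r) m
    refine ⟨z'', hz'', ?_⟩
    rw [Nat.succ_mul, ← add_assoc]
    simpa only [Function.iterate_succ_apply'] using h''

/-- The series is subtracted here, but every partial result is at least `(ω z) ^ 2`, so the ReLU
never truncates the accumulator. -/
theorem square_step (h : ReachableOn K L ![X, T, A, z, z, fun _ => 0])
    (hX : ∀ x ∈ K, 0 ≤ X x) (hT : ∀ x ∈ K, 0 ≤ T x) (hA : ∀ x ∈ K, 0 ≤ A x)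
    (hz : ∀ x ∈ K, z x ∈ Set.Icc (0 : ℝ) 1) {ω : ℝ} (hω : ω ∈ Set.Icc (0 : ℝ) 1) (m : ℕ) :
    ∃ z' : ℝ → ℝ, (∀ x ∈ K, 0 ≤ z' x) ∧ ReachableOn K (L + (1 + 2 * m))
      ![X, T, fun x => squareApprox m (ω * z x), z', z', fun _ => 0] := by
  have h0 : (0 : ℝ) ∈ Set.Icc (0 : ℝ) 1 := by simp
  have hw : ∀ x ∈ K, ω * z x ∈ Set.Icc (0 : ℝ) 1 := fun x hx =>
    ⟨mul_nonneg hω.1 (hz x hx).1, mul_le_one₀ hω.2 (hz x hx).1 (hz x hx).2⟩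
  have h1 := h.combine hX hT hA (fun x hx => (hz x hx).1) (c₁ := 0) (c₂ := ω) (c₃ := 0) (c₄ := 0)
    (c₅ := ω) h0 hω h0 h0 hω (T' := T) (A' := fun x => ω * z x) (z' := fun x => ω * z x)
    (by simp) (by simp) (by simp)
  have e (m : ℕ) (x : ℝ) : ω * z x + ∑ k ∈ Finset.range m,
      -(1 / 4 * (1 / 4) ^ k) * tent^[k + 1] (ω * z x) = squareApprox m (ω * z x) := by
    rw [squareApprox, logisticApprox, Finset.mul_sum, sub_eq_add_neg, ← Finset.sum_neg_distrib]
    congr 1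
    exact Finset.sum_congr rfl fun k _ => by ring
  have h2 := h1.tent_iterate hX hT hw (c := fun k => -(1 / 4 * (1 / 4) ^ k))
    (fun k => by
      rw [abs_neg, abs_of_nonneg (by positivity)]
      exact mul_le_one₀ (by norm_num) (by positivity) (pow_le_one₀ (by norm_num) (by norm_num)))
    (fun m x hx => by rw [e]; exact (squareApprox_mem_Icc (hw x hx) m).1) m
  refine ⟨_, fun x hx => (tent_iterate_mem_Icc (hw x hx) m).1, ?_⟩
  rw [← add_assoc]
  simpa only [e] using h2

/-- Layers that add an approximation of `q * sin (π 2 ^ M β X / 2) ^ 2` to the register `T`. -/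
theorem sinSq_step (h : ReachableOn K L ![X, T, A, z, z, fun _ => 0])
    (hX : ∀ x ∈ K, 0 ≤ X x) (hT : ∀ x ∈ K, 0 ≤ T x) (hA : ∀ x ∈ K, 0 ≤ A x)
    (hz : ∀ x ∈ K, 0 ≤ z x) {β : ℝ} (hβ : β ∈ Set.Icc (0 : ℝ) 1)
    (hβX : ∀ x ∈ K, β * X x ≤ 1) {q : ℝ} (hq : q ∈ Set.Icc (0 : ℝ) 1) (M : ℕ) {r : ℕ}
    (hr : 1 ≤ r) :
    ReachableOn K (L + (1 + 2 * M + (1 + 2 * (2 * r)) + r * (1 + 2 * (2 * r)) + 1))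
      ![X, fun x => T x + q * sinSqApprox r (tent^[M] (β * X x)), fun _ => 0, fun _ => 0,
        fun _ => 0, fun _ => 0] := by
  have h0 : (0 : ℝ) ∈ Set.Icc (0 : ℝ) 1 := by simp
  have hw : ∀ x ∈ K, β * X x ∈ Set.Icc (0 : ℝ) 1 := fun x hx =>
    ⟨mul_nonneg hβ.1 (hX x hx), hβX x hx⟩
  have h1 := h.combine hX hT hA hz (c₁ := 0) (c₂ := 0) (c₃ := β) (c₄ := 0)
    (c₅ := 0) h0 h0 hβ h0 h0 (T' := T) (A' := fun x => 0) (z' := fun x => β * X x)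
    (by simp) (by simp) (by simp)
  -- Zero coefficients: pure folding, with nothing accumulated.
  have h2 := h1.tent_iterate hX hT hw (c := fun _ => 0) (by simp) (by simp) M
  have hM : ∀ x ∈ K, tent^[M] (β * X x) ∈ Set.Icc (0 : ℝ) 1 := fun x hx =>
    tent_iterate_mem_Icc (hw x hx) M
  obtain ⟨z₃, hz₃, h3⟩ := h2.square_step hX hT (by simp) hM
    ⟨by positivity, pi_div_two_pow_le_one hr⟩ (2 * r)
  obtain ⟨z₄, hz₄, h4⟩ := h3.logistic_iterate hX hT hz₃
    (fun x hx => squareApprox_mem_Icc (pi_div_two_pow_mul_mem_Icc hr (hM x hx)) _) (2 * r) r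
  have h5 := h4.combine hX hT (fun x hx => (sinSqApprox_mem_Icc hr (hM x hx)).1) hz₄ (c₁ := q)
    (c₂ := 0) (c₃ := 0) (c₄ := 0) (c₅ := 0) hq h0 h0 h0 h0
    (T' := fun x => T x + q * sinSqApprox r (tent^[M] (β * X x))) (A' := fun _ => 0)
    (z' := fun _ => 0) (fun x _ => rfl) (by simp) (by simp)
  simpa only [add_assoc] using h5

/-- The accumulated sum for the partial sum of the Weierstrass function. -/
theorem weierstrass_sum {D p a : ℝ} (hp : p ∈ Set.Icc (0 : ℝ) 1) (ha : 0 ≤ a) {M N r : ℕ}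
    (hr : 1 ≤ r) (hM : ∀ k < N, a ^ k / 2 ^ M ≤ 1) (hMD : ∀ k < N, a ^ k / 2 ^ M * D ≤ 1) :
    ReachableOn (Set.Icc (-D) D)
      (2 + N * (1 + 2 * M + (1 + 2 * (2 * r)) + r * (1 + 2 * (2 * r)) + 1))
      ![fun x => |x|, fun x => ∑ k ∈ Finset.range N,
        p ^ k * sinSqApprox r (tent^[M] (a ^ k / 2 ^ M * |x|)),
        fun _ => 0, fun _ => 0, fun _ => 0, fun _ => 0] := by
  induction N with
  | zero => simpa using abs_input _
  | succ N ih =>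
    have hβX (k : ℕ) (hk : k < N + 1) (x : ℝ) (hx : x ∈ Set.Icc (-D) D) :
        a ^ k / 2 ^ M * |x| ≤ 1 :=
      (mul_le_mul_of_nonneg_left (abs_le.2 hx) (by positivity)).trans (hMD k hk)
    have := (ih (fun k hk => hM k (by omega)) (fun k hk => hMD k (by omega))).sinSq_step
      (fun x _ => abs_nonneg x)
      (fun x hx => Finset.sum_nonneg fun k hk => mul_nonneg (pow_nonneg hp.1 k)
        (sinSqApprox_mem_Icc hr (tent_iterate_mem_Icc ⟨by positivity,
          hβX k ((Finset.mem_range.1 hk).trans N.lt_succ_self) x hx⟩ M)).1)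
      (by simp) (by simp) ⟨by positivity, hM N (by omega)⟩ (hβX N (by omega))
      ⟨pow_nonneg hp.1 N, pow_le_one₀ hp.1 hp.2⟩ M hr
    rw [Nat.succ_mul, ← add_assoc]
    simpa only [Finset.sum_range_succ] using this

end ReachableOn

/-! ### Error estimates and choice of parameters -/

theorem geom_sum_le_two {p : ℝ} (hp0 : 0 ≤ p) (hp : p ≤ 1 / 2) (N : ℕ) :
    ∑ k ∈ Finset.range N, p ^ k ≤ 2 := by
  have hs := summable_geometric_of_lt_one hp0 (by linarith : p < 1)
  refine (hs.sum_le_tsum _ fun k _ => pow_nonneg hp0 k).trans ?_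
  rw [tsum_geometric_of_lt_one hp0 (by linarith), inv_le_comm₀ (by linarith) two_pos]
  linarith

theorem abs_weierstrassFn_sub_sum_le {p : ℝ} (hp0 : 0 < p) (hp : p ≤ 1 / 2) (a x : ℝ) (N : ℕ) :
    |weierstrassFn p a x - ∑ k ∈ Finset.range N, p ^ k * Real.cos (a ^ k * Real.pi * x)| ≤
      2 * (1 / 2) ^ N := by
  rw [weierstrassFn, ← (weierstrassFn_summable hp0 (by linarith) a x).sum_add_tsum_nat_add N,
    add_sub_cancel_left, ← Real.norm_eq_abs]
  have hg : HasSum (fun k : ℕ => p ^ N * p ^ k) (p ^ N * (1 - p)⁻¹) :=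
    (hasSum_geometric_of_lt_one hp0.le (by linarith)).mul_left _
  refine (tsum_of_norm_bounded hg fun k => ?_).trans ?_
  · rw [norm_mul, Real.norm_eq_abs, Real.norm_eq_abs, abs_of_pos (pow_pos hp0 _), pow_add,
      mul_comm (p ^ k)]
    exact mul_le_of_le_one_right (by positivity) (Real.abs_cos_le_one _)
  · rw [mul_comm]
    have h1 : (1 - p)⁻¹ ≤ 2 := by
      rw [inv_le_comm₀ (by linarith) two_pos]; linarith
    have h2 : p ^ N ≤ (1 / 2) ^ N := pow_le_pow_left₀ hp0.le hp N
    exact mul_le_mul h1 h2 (by positivity) zero_le_two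

/-- The partial sum of the Weierstrass function is approximated by the accumulated sum. -/
theorem abs_partial_sum_sub_le {p a D : ℝ} (hp0 : 0 < p) (hp : p ≤ 1 / 2) (ha : 0 ≤ a)
    {M N r : ℕ} (hr : 1 ≤ r) (hMD : ∀ k < N, a ^ k / 2 ^ M * D ≤ 1) {x : ℝ} (hx : |x| ≤ D) :
    |∑ k ∈ Finset.range N, p ^ k - 2 * (∑ k ∈ Finset.range N,
        p ^ k * sinSqApprox r (tent^[M] (a ^ k / 2 ^ M * |x|))) -
      ∑ k ∈ Finset.range N, p ^ k * Real.cos (a ^ k * Real.pi * x)| ≤ 24 * (1 / 4) ^ r := by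
  rw [Finset.mul_sum, ← Finset.sum_sub_distrib, ← Finset.sum_sub_distrib]
  refine (Finset.abs_sum_le_sum_abs _ _).trans ?_
  have key : ∀ k ∈ Finset.range N, |p ^ k -
      2 * (p ^ k * sinSqApprox r (tent^[M] (a ^ k / 2 ^ M * |x|))) -
      p ^ k * Real.cos (a ^ k * Real.pi * x)| ≤ p ^ k * (12 * (1 / 4) ^ r) := by
    intro k hk
    have hz : a ^ k / 2 ^ M * |x| ∈ Set.Icc (0 : ℝ) 1 :=
      ⟨by positivity, (mul_le_mul_of_nonneg_left hx (by positivity)).trans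
        (hMD k (Finset.mem_range.1 hk))⟩
    -- Unfolding the tent iterates gives the angle `|a ^ k * π * x|`, whose absolute value the
    -- cosine ignores.
    have hcos : Real.cos (a ^ k * Real.pi * x) =
        1 - 2 * Real.sin (Real.pi * tent^[M] (a ^ k / 2 ^ M * |x|) / 2) ^ 2 := by
      have h1 := cos_pi_mul_tent_iterate M (a ^ k / 2 ^ M * |x|)
      have e : Real.pi * (2 ^ M * (a ^ k / 2 ^ M * |x|)) = |a ^ k * Real.pi * x| := by
        rw [abs_mul, abs_of_nonneg (by positivity : 0 ≤ a ^ k * Real.pi)]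
        field_simp
      rw [e, Real.cos_abs] at h1
      rw [← h1, Real.sin_sq_eq_half_sub]
      ring_nf
    have h := abs_sinSqApprox_sub_le hr (tent_iterate_mem_Icc hz M)
    rw [hcos]
    set s := sinSqApprox r (tent^[M] (a ^ k / 2 ^ M * |x|))
    set t := Real.sin (Real.pi * tent^[M] (a ^ k / 2 ^ M * |x|) / 2) ^ 2
    rw [show p ^ k - 2 * (p ^ k * s) - p ^ k * (1 - 2 * t) = p ^ k * (-2 * (s - t)) by ring,
      abs_mul, abs_mul, abs_of_pos (pow_pos hp0 k), abs_neg, abs_two]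
    refine mul_le_mul_of_nonneg_left ?_ (pow_pos hp0 k).le
    linarith
  refine (Finset.sum_le_sum key).trans ?_
  rw [← Finset.sum_mul]
  have := geom_sum_le_two hp0.le hp N
  have h4 : (0 : ℝ) < (1 / 4) ^ r := by positivity
  nlinarith

/-- An approximating network for given numbers `N` of summands and angle doublings and `M` of
tent map iterations. -/
theorem exists_network_weierstrassFn {p a D δ : ℝ} (hp0 : 0 < p) (hp : p ≤ 1 / 2) (ha : 0 ≤ a)
    (hδ : 0 < δ) {M N : ℕ} (hN : 1 ≤ N) (hM : ∀ k < N, a ^ k / 2 ^ M ≤ 1)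
    (hMD : ∀ k < N, a ^ k / 2 ^ M * D ≤ 1) :
    ∃ Ψ : ReLUNetwork 1 1, Ψ.Nondegenerate ∧
      (∀ x ∈ Set.Icc (-D) D, |Ψ.eval (fun _ => x) 0 - weierstrassFn p a x| ≤
        δ + 24 * (1 / 4) ^ N + 2 * (1 / 2) ^ N) ∧
      Ψ.depth = N * (3 + 2 * M + 5 * N + 4 * N ^ 2) + 4 ∧ Ψ.width ≤ 6 ∧
      Ψ.weightMagnitude ≤ 1 := by
  have h1 := ReachableOn.weierstrass_sum (D := D) (p := p) ⟨hp0.le, by linarith⟩ ha hN hM hMD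
  set S : ℝ → ℝ := fun x => ∑ k ∈ Finset.range N,
    p ^ k * sinSqApprox N (tent^[M] (a ^ k / 2 ^ M * |x|)) with hS
  set c := ∑ k ∈ Finset.range N, p ^ k with hc
  have hc0 : 0 ≤ c := Finset.sum_nonneg fun k _ => pow_nonneg hp0.le k
  have hc2 : c ≤ 2 := geom_sum_le_two hp0.le hp N
  have hS0 : ∀ x ∈ Set.Icc (-D) D, 0 ≤ S x := fun x hx =>
    Finset.sum_nonneg fun k hk => mul_nonneg (pow_nonneg hp0.le k)
      (sinSqApprox_mem_Icc hN (tent_iterate_mem_Icc ⟨by positivity,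
        (mul_le_mul_of_nonneg_left (abs_le.2 hx) (by positivity)).trans
          (hMD k (Finset.mem_range.1 hk))⟩ M)).1
  -- The output `c - 2 S` is prepared with weights at most 1: `S` is duplicated, and `c ≤ 2` is
  -- split into two biases `c / 2`.
  have h2 : ReachableOn (Set.Icc (-D) D)
      (2 + N * (1 + 2 * M + (1 + 2 * (2 * N)) + N * (1 + 2 * (2 * N)) + 1) + 1)
      ![S, S, fun _ => c / 2, fun _ => c / 2, fun _ => 0, fun _ => 0] := by
    refine .step
      !![0, 1, 0, 0, 0, 0; 0, 1, 0, 0, 0, 0; 0, 0, 0, 0, 0, 0; 0, 0, 0, 0, 0, 0;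
        0, 0, 0, 0, 0, 0; 0, 0, 0, 0, 0, 0] ![0, 0, c / 2, c / 2, 0, 0] ?_ ?_ h1 ?_
    · intro i j; fin_cases i <;> fin_cases j <;> simp
    · have : |c / 2| ≤ 1 := by rw [abs_of_nonneg (by positivity)]; linarith
      intro i; fin_cases i <;> simp only [Fin.reduceFinMk] <;> simp [this]
    · intro x hx i
      have hcc : 0 ≤ c / 2 := by positivity
      have hSx := hS0 x hx
      fin_cases i <;> simp [Fin.sum_univ_succ, relu_of_nonneg, hSx, hcc]
  -- The last two entries act on zero registers; they are nonzero only for nondegeneracy.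
  let B : Matrix (Fin 1) (Fin 6) ℝ := !![-1, -1, 1, 1, 1, 1]
  have hB0 : ∀ i j, B i j ≠ 0 := by intro i j; fin_cases i; fin_cases j <;> simp [B]
  have hB1 : ∀ i j, |B i j| ≤ 1 := by intro i j; fin_cases i; fin_cases j <;> simp [B]
  obtain ⟨Ψ, hΨ, hdepth, hwidth, hmag, hdist⟩ := h2.exists_network (fun x hx => abs_le.2 hx)
    le_rfl (by norm_num) (.affine B 0) (And.intro (fun j => ⟨0, hB0 0 j⟩) fun i => ⟨0, hB0 i 0⟩)
    (by simp [ReLUNetwork.width])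
    (ReLUNetwork.affineMagnitude_le_one hB1 (by simp)) hδ
  refine ⟨Ψ, hΨ, fun x hx => ?_, ?_, hwidth, hmag⟩
  · have e1 := (dist_le_pi_dist _ _ 0).trans (hdist x hx)
    have e2 := abs_partial_sum_sub_le hp0 hp ha hN hMD (abs_le.2 hx)
    have e3 := abs_weierstrassFn_sub_sum_le hp0 hp a x N
    have e4 : ReLUNetwork.eval (.affine B 0)
        (fun i => (![S, S, fun _ => c / 2, fun _ => c / 2, fun _ => 0, fun _ => 0] :
          Fin 6 → ℝ → ℝ) i x) (0 : Fin 1) = c - 2 * S x := by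
      simp [B, ReLUNetwork.eval, Matrix.mulVec, dotProduct]
      ring
    rw [Real.dist_eq, e4] at e1
    have e5 := abs_sub_le (Ψ.eval (fun _ => x) 0) (c - 2 * S x) (weierstrassFn p a x)
    have e6 := abs_sub_le (c - 2 * S x)
      (∑ k ∈ Finset.range N, p ^ k * Real.cos (a ^ k * Real.pi * x)) (weierstrassFn p a x)
    rw [abs_sub_comm (∑ k ∈ Finset.range N, p ^ k * Real.cos (a ^ k * Real.pi * x))] at e6
    linarith
  · rw [hdepth, ReLUNetwork.depth]; ring

theorem mainTheorem10 :
    ∃ C : ℝ, 0 < C ∧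
      ∀ ε p D a : ℝ, 0 < ε → ε < 1 / 2 → 0 < p → p < 1 / 2 → 0 < D → 0 < a →
        ∃ Ψ : ReLUNetwork 1 1,
          Ψ.Nondegenerate ∧
          (∀ x ∈ Set.Icc (-D) D, |Ψ.eval (fun _ => x) 0 - weierstrassFn p a x| ≤ ε) ∧
          (Ψ.depth : ℝ) ≤
            C * ((Real.logb 2 ε⁻¹) ^ 3
              + (Real.logb 2 ε⁻¹) ^ 2 * Real.logb 2 (⌈a⌉₊ : ℝ)
              + Real.logb 2 ε⁻¹ * Real.logb 2 (⌈D⌉₊ : ℝ)) ∧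
          Ψ.width ≤ 13 ∧
          Ψ.weightMagnitude ≤ 1 := by
  refine ⟨4000, by norm_num, fun ε p D a hε hε2 hp0 hp hD ha => ?_⟩
  set l := Real.logb 2 ε⁻¹ with hl
  have ha1 : (1 : ℝ) ≤ (⌈a⌉₊ : ℝ) := by exact_mod_cast Nat.ceil_pos.2 ha
  have hD1 : (1 : ℝ) ≤ (⌈D⌉₊ : ℝ) := by exact_mod_cast Nat.ceil_pos.2 hD
  have hl1 : 1 ≤ l := by
    rw [hl, Real.le_logb_iff_rpow_le one_lt_two (by positivity), Real.rpow_one,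
      le_inv_comm₀ two_pos hε]
    linarith
  have hla : 0 ≤ Real.logb 2 (⌈a⌉₊ : ℝ) := Real.logb_nonneg one_lt_two ha1
  have hlD : 0 ≤ Real.logb 2 (⌈D⌉₊ : ℝ) := Real.logb_nonneg one_lt_two hD1
  -- `N` counts both summands and angle doublings. The extra 4 gives `(1 / 2) ^ N ≤ ε / 16`, so both
  -- approximation errors fit beside the perturbation error `ε / 2`.
  set N := ⌈l⌉₊ + 4 with hN
  -- Hence `2 ^ M` dominates `a ^ k` and `a ^ k * D` for all `k < N`; the ceilings also cover `a <
  -- 1` and `D < 1`.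
  set M := ⌈Real.logb 2 ((⌈a⌉₊ : ℝ) ^ N * ⌈D⌉₊)⌉₊ with hM
  have hprod : 1 ≤ (⌈a⌉₊ : ℝ) ^ N := one_le_pow₀ ha1
  have hlogM : Real.logb 2 ((⌈a⌉₊ : ℝ) ^ N * ⌈D⌉₊) =
      N * Real.logb 2 (⌈a⌉₊ : ℝ) + Real.logb 2 (⌈D⌉₊ : ℝ) := by
    rw [Real.logb_mul (by positivity) (by positivity), Real.logb_pow]
  have hM1 : (⌈a⌉₊ : ℝ) ^ N * ⌈D⌉₊ ≤ 2 ^ M := by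
    rw [← Real.rpow_natCast 2 M, ← Real.logb_le_iff_le_rpow one_lt_two (by positivity)]
    exact Nat.le_ceil _
  have hM2 : (M : ℝ) ≤ N * Real.logb 2 (⌈a⌉₊ : ℝ) + Real.logb 2 (⌈D⌉₊ : ℝ) + 1 := by
    rw [← hlogM]
    refine (Nat.ceil_lt_add_one ?_).le
    rw [hlogM]; positivity
  have hpow : ∀ k < N, a ^ k ≤ (⌈a⌉₊ : ℝ) ^ N := fun k hk =>
    (pow_le_pow_left₀ ha.le (Nat.le_ceil a) k).trans (pow_le_pow_right₀ ha1 hk.le)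
  have hNε : (1 / 2 : ℝ) ^ N ≤ ε / 16 := by
    have h1 : ε⁻¹ ≤ 2 ^ ⌈l⌉₊ := by
      rw [← Real.rpow_natCast, ← Real.logb_le_iff_le_rpow one_lt_two (by positivity)]
      exact Nat.le_ceil _
    have h2 := inv_anti₀ (by positivity) h1
    rw [inv_inv] at h2
    rw [hN, pow_add, one_div, inv_pow]
    linarith
  obtain ⟨Ψ, hΨ, happrox, hdepth, hwidth, hmag⟩ := exists_network_weierstrassFn (D := D) hp0 hp.le
    ha.le (half_pos hε) (by omega : 1 ≤ N) (M := M)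
    (fun k hk => by
      rw [div_le_one (by positivity)]
      exact (hpow k hk).trans ((le_mul_of_one_le_right (by positivity) hD1).trans hM1))
    (fun k hk => by
      rw [div_mul_eq_mul_div, div_le_one (by positivity)]
      exact (mul_le_mul (hpow k hk) (Nat.le_ceil D) hD.le (by positivity)).trans hM1)
  refine ⟨Ψ, hΨ, fun x hx => (happrox x hx).trans ?_, ?_, hwidth.trans (by norm_num), hmag⟩
  · have h4 : (1 / 4 : ℝ) ^ N = (1 / 2) ^ N * (1 / 2) ^ N := by rw [← mul_pow]; norm_num
    have h0 : (0 : ℝ) ≤ (1 / 2) ^ N := by positivity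
    rw [h4]
    nlinarith
  · set α := Real.logb 2 (⌈a⌉₊ : ℝ)
    set γ := Real.logb 2 (⌈D⌉₊ : ℝ)
    have hN1 : (1 : ℝ) ≤ N := by exact_mod_cast (by omega : 1 ≤ N)
    have hNl : (N : ℝ) ≤ 6 * l := by
      have := Nat.ceil_lt_add_one (zero_le_one.trans hl1)
      rw [hN]; push_cast; linarith
    rw [hdepth]
    push_cast
    have b1 : (N : ℝ) ≤ N ^ 3 := le_self_pow₀ hN1 (by norm_num)
    have b2 : (N : ℝ) ^ 2 ≤ N ^ 3 := pow_le_pow_right₀ hN1 (by norm_num)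
    have b3 : (N : ℝ) * M ≤ N * (N * α + γ + 1) := by gcongr
    have b4 : (N : ℝ) ^ 3 ≤ (6 * l) ^ 3 := by gcongr
    have b5 : (N : ℝ) ^ 2 * α ≤ (6 * l) ^ 2 * α := by gcongr
    have b6 : (N : ℝ) * γ ≤ 6 * l * γ := by gcongr
    have b7 : 0 ≤ l ^ 2 * α := by positivity
    have b8 : 0 ≤ l * γ := by positivity
    have b9 : 0 ≤ l ^ 3 := by positivity
    calc (N : ℝ) * (3 + 2 * M + 5 * N + 4 * N ^ 2) + 4
        = 3 * N + 2 * (N * M) + 5 * N ^ 2 + 4 * N ^ 3 + 4 := by ring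
      _ ≤ 3 * N + 2 * (N * (N * α + γ + 1)) + 5 * N ^ 2 + 4 * N ^ 3 + 4 * N := by linarith
      _ = 9 * N + 5 * N ^ 2 + 4 * N ^ 3 + 2 * (N ^ 2 * α) + 2 * (N * γ) := by ring
      _ ≤ 18 * (6 * l) ^ 3 + 2 * ((6 * l) ^ 2 * α) + 2 * (6 * l * γ) := by linarith
      _ = 3888 * l ^ 3 + 72 * (l ^ 2 * α) + 12 * (l * γ) := by ring
      _ ≤ 4000 * (l ^ 3 + l ^ 2 * α + l * γ) := by linarith
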